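/- Let $n\ge 2$, let $D\subseteq\{0,1\}^n\times\{0,1\}^n$ and let $f$ be a Boolean function on $D$ (a promise problem; $D=\{0,1\}^n\times\{0,1\}^n$ is the case of a total function). A protocol computes $f$ with bounded error if on every $(x,y)\in D$ it outputs $f(x,y)$ with probability at least $2/3$. Let $Q^{ent}(f)$ be the minimal number of qubits of communication of a two-party quantum protocol that computes $f$ with bounded error, where any number of rounds is allowed, the parties start with an arbitrary input-independent entangled pure state of arbitrary finite dimension, which is not counted in the cost, and at the end one of the parties outputs the result of a local measurement. Let $Q^{\parallel}(f)$ be the minimal total number of qubits sent in a simultaneous message passing (SMP) protocol that computes $f$ with bounded error, in which Alice and Bob, without shared randomness or entanglement, each send one quantum state to a referee, who outputs the result of a two-outcome measurement. A repeated fingerprinting protocol with $k$-qubit fingerprints and $r$ repetitions is an SMP protocol in which Alice sends $r$ copies of a pure $k$-qubit state $|\alpha_x\rangle$, Bob sends $r$ copies of a pure $k$-qubit state $|\beta_y\rangle$, and the referee performs the swap test on each of the $r$ pairs (each test independently gives outcome $0$ with probability $\frac12+\frac12|\langle\alpha_x|\beta_y\rangle|^2$) and outputs $1$ if and only if the number of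 outcomes $0$ reaches a fixed threshold. Its communication is $2kr$ qubits. There is an absolute constant $C>0$ such that for all such $n$, $D$ and $f$ the following holds ($\log$ is to base $2$). 1. For every multi-round quantum protocol with $q$ qubits of communication and prior entanglement that computes $f$ with bounded error, there is a repeated fingerprinting protocol (without shared resources) that computes $f$ with bounded error, with $k\le C(q+\log n)$, $r\le C\,2^{8q}$ and total communication $2kr\le C\,2^{8q}\log n$. 2. $Q^{\parallel}(f)\le C\,2^{8Q^{ent}(f)}\log n$. -/

import Mathlib

open scoped Kronecker ComplexOrder

namespace QFP

/-- A matrix `E` with `0 ≤ E ≤ 1`: the operator of the outcome "1" in a two-outcome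
quantum measurement. -/
def IsEffect {ι : Type} [Fintype ι] [DecidableEq ι] (E : Matrix ι ι ℂ) : Prop :=
  E.PosSemidef ∧ (1 - E).PosSemidef

/-- A density matrix: positive semidefinite of trace one. -/
def IsDensity {ι : Type} [Fintype ι] (ρ : Matrix ι ι ℂ) : Prop :=
  ρ.PosSemidef ∧ ρ.trace = 1

/-- The acceptance probabilities `P x y` compute the Boolean function `f`, restricted to the
promise set `D`, with error probability at most `1/3` on every allowed input
(`D = Set.univ` is the case of a total function). -/
def BoundedError {X Y : Type} (D : Set (X × Y)) (f : X → Y → Bool) (P : X → Y → ℝ) : Prop :=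
  ∀ x y, (x, y) ∈ D → (f x y = true → 2 / 3 ≤ P x y) ∧ (f x y = false → P x y ≤ 1 / 3)

/-! ## Interactive protocols with prior entanglement -/

/-- The interaction of a two-party quantum protocol in which exactly `q` qubits are still to be
sent, when Alice holds a register of dimension `a` and Bob one of dimension `b`.

* `sendA`: Alice applies an isometry depending on her input (that is, she adds fresh ancillas
  and applies a unitary), which turns her register into a register of dimension `a'` and one
  qubit, and sends the qubit to Bob.
* `sendB`: the same with the roles exchanged.
* `outA`, `outB`: Alice, respectively Bob, measures the own register and outputs the outcome.

The directions of the messages are arbitrary (and independent of the inputs), so a message of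
several qubits is a block of consecutive sends, and the number of rounds is not restricted. -/
inductive Interaction (X Y : Type) : ℕ → ℕ → ℕ → Type
  | outA {a b : ℕ} (E : X → Matrix (Fin a) (Fin a) ℂ) (hE : ∀ x, IsEffect (E x)) :
      Interaction X Y a b 0
  | outB {a b : ℕ} (E : Y → Matrix (Fin b) (Fin b) ℂ) (hE : ∀ y, IsEffect (E y)) :
      Interaction X Y a b 0
  | sendA {a b q : ℕ} (a' : ℕ) (V : X → Matrix (Fin a' × Fin 2) (Fin a) ℂ)
      (hV : ∀ x, (V x).conjTranspose * V x = 1) (rest : Interaction X Y a' (b * 2) q) :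
      Interaction X Y a b (q + 1)
  | sendB {a b q : ℕ} (b' : ℕ) (V : Y → Matrix (Fin b' × Fin 2) (Fin b) ℂ)
      (hV : ∀ y, (V y).conjTranspose * V y = 1) (rest : Interaction X Y (a * 2) b' q) :
      Interaction X Y a b (q + 1)

/-- The joint state after Alice has applied the isometry `V` and sent the qubit to Bob.
A pure state of the two registers is given by the matrix of its amplitudes, the rows being
indexed by Alice's basis states and the columns by Bob's. -/
def transferA {a a' b : ℕ} (V : Matrix (Fin a' × Fin 2) (Fin a) ℂ)
    (Ψ : Matrix (Fin a) (Fin b) ℂ) : Matrix (Fin a') (Fin (b * 2)) ℂ :=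
  Matrix.of fun i j => (V * Ψ) (i, (finProdFinEquiv.symm j).2) (finProdFinEquiv.symm j).1

/-- The joint state after Bob has applied the isometry `V` and sent the qubit to Alice. -/
def transferB {a b b' : ℕ} (V : Matrix (Fin b' × Fin 2) (Fin b) ℂ)
    (Ψ : Matrix (Fin a) (Fin b) ℂ) : Matrix (Fin (a * 2)) (Fin b') ℂ :=
  Matrix.of fun i j => (Ψ * V.transpose) (finProdFinEquiv.symm i).1 (j, (finProdFinEquiv.symm i).2)

/-- The probability that the output is `1` on inputs `x`, `y`, when the interaction is run on
the joint pure state with amplitudes `Ψ`. -/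
noncomputable def Interaction.acceptProb {X Y : Type} (x : X) (y : Y) :
    {a b q : ℕ} → Interaction X Y a b q → Matrix (Fin a) (Fin b) ℂ → ℝ
  | _, _, _, .outA E _, Ψ => (Ψ.conjTranspose * E x * Ψ).trace.re
  | _, _, _, .outB E _, Ψ => (Ψ * (E y).transpose * Ψ.conjTranspose).trace.re
  | _, _, _, .sendA _ V _ rest, Ψ => rest.acceptProb x y (transferA (V x) Ψ)
  | _, _, _, .sendB _ V _ rest, Ψ => rest.acceptProb x y (transferB (V y) Ψ)

/-- A multi-round two-party quantum protocol with `q` qubits of communication, which starts with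
an arbitrary input-independent (entangled) unit vector in `ℂ^a ⊗ ℂ^b`, of arbitrary finite
dimensions, shared by Alice and Bob. -/
structure EntProtocol (X Y : Type) (q : ℕ) where
  a : ℕ
  b : ℕ
  Ψ : Matrix (Fin a) (Fin b) ℂ
  unit : ∑ i, ∑ j, ‖Ψ i j‖ ^ 2 = 1
  run : Interaction X Y a b q

/-- The probability that the protocol outputs `1`. -/
noncomputable def EntProtocol.acceptProb {X Y : Type} {q : ℕ} (P : EntProtocol X Y q)
    (x : X) (y : Y) : ℝ :=
  P.run.acceptProb x y P.Ψ

/-- The minimal number of qubits of communication of a multi-round quantum protocol with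
unlimited prior entanglement that computes `f` on `D` with error at most `1/3`. -/
noncomputable def Qent {X Y : Type} (D : Set (X × Y)) (f : X → Y → Bool) : ℕ :=
  sInf {q : ℕ | ∃ P : EntProtocol X Y q, BoundedError D f P.acceptProb}

/-! ## Simultaneous message passing without shared resources -/

/-- A quantum simultaneous message passing protocol without shared randomness or entanglement:
Alice sends a (possibly mixed) state of `a` qubits, Bob one of `b` qubits, and the referee
performs a joint two-outcome measurement. -/
structure SMPProtocol (X Y : Type) (a b : ℕ) where
  ρ : X → Matrix (Fin (2 ^ a)) (Fin (2 ^ a)) ℂ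
  σ : Y → Matrix (Fin (2 ^ b)) (Fin (2 ^ b)) ℂ
  E : Matrix (Fin (2 ^ a) × Fin (2 ^ b)) (Fin (2 ^ a) × Fin (2 ^ b)) ℂ
  density_ρ : ∀ x, IsDensity (ρ x)
  density_σ : ∀ y, IsDensity (σ y)
  effect : IsEffect E

/-- The probability that the referee outputs `1`. -/
noncomputable def SMPProtocol.acceptProb {X Y : Type} {a b : ℕ} (P : SMPProtocol X Y a b)
    (x : X) (y : Y) : ℝ :=
  (P.E * (P.ρ x ⊗ₖ P.σ y)).trace.re

/-- The minimal total number of qubits sent in a quantum simultaneous message passing protocol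
without shared resources that computes `f` on `D` with error at most `1/3`. -/
noncomputable def Qpar {X Y : Type} (D : Set (X × Y)) (f : X → Y → Bool) : ℕ :=
  sInf {c : ℕ | ∃ a b : ℕ, c = a + b ∧
    ∃ P : SMPProtocol X Y a b, BoundedError D f P.acceptProb}

/-! ## Repeated fingerprinting -/

/-- A repeated fingerprinting protocol: Alice and Bob send `r` copies of their `k`-qubit pure
states `α x`, `β y`, and the referee performs the swap test on each of the `r` pairs. The
estimate of `|⟨α x, β y⟩|` is an increasing function of the number of tests with outcome `0`;
the referee outputs `1` if and only if this number is at least `threshold`. -/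
structure RepeatedFingerprinting (X Y : Type) (k r : ℕ) where
  α : X → EuclideanSpace ℂ (Fin (2 ^ k))
  β : Y → EuclideanSpace ℂ (Fin (2 ^ k))
  norm_α : ∀ x, ‖α x‖ = 1
  norm_β : ∀ y, ‖β y‖ = 1
  threshold : ℕ

/-- The probability that one swap test gives the outcome `0`. -/
noncomputable def RepeatedFingerprinting.swapProb {X Y : Type} {k r : ℕ}
    (F : RepeatedFingerprinting X Y k r) (x : X) (y : Y) : ℝ :=
  1 / 2 + ‖inner ℂ (F.α x) (F.β y)‖ ^ 2 / 2

/-- The probability that the referee outputs `1`: the sum of the probabilities of all accepted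
strings of outcomes of the `r` independent swap tests. -/
noncomputable def RepeatedFingerprinting.acceptProb {X Y : Type} {k r : ℕ}
    (F : RepeatedFingerprinting X Y k r) (x : X) (y : Y) : ℝ :=
  ∑ o : Fin r → Fin 2,
    if F.threshold ≤ (Finset.univ.filter fun i => o i = 0).card then
      ∏ i, (if o i = 0 then F.swapProb x y else 1 - F.swapProb x y)
    else 0

end QFP

namespace QFP

/-! Expanding each transmitted qubit in the computational basis, in the ket and in the bra,
multiplies the number of terms by 4. The acceptance probability is therefore the real part of a sum
of 4^q terms tr(A Ψ B Ψ†) with contractions A depending only on x and B only on y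
(`Interaction.acceptProb_eq_sum`). Since Ψ has Frobenius norm 1, this is an inner product of real
vectors of squared norm at most 4^q (`EntProtocol.acceptProb_eq_inner`). The entanglement only
affects their dimension, over which there is no control.

After division by 2^q the vectors have norm at most 1, and their inner products still separate the
two values of f by 4^(-q)/3. Truncated random sign sums (`exists_dimension_reduction`) preserve all
inner products of these 2^(n+1) vectors to within 4^(-q)/12 in dimension of order n 2^(8q), so O(q +
log n) qubits hold a fingerprint. Padding (`exists_unit_vectors`) yields unit vectors with overlap
1/2 plus a quarter of the reduced inner product. The offset makes squaring monotone and keeps the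
gap of the squared overlaps linear in 4^(-q), so by Chernoff O(2^(4q)) swap tests suffice. The
unused factor 2^(4q) in the claimed bound absorbs the q in the fingerprint size.

For the second claim, the swap tests are written as one referee measurement
(`RepeatedFingerprinting.exists_smpProtocol`), and the trivial protocol (`exists_entProtocol`)
ensures that the infimum defining `Qent` is attained. -/

/-! ### Contractions, and unrolling a protocol into an inner product -/

open scoped Matrix.Norms.L2Operator MatrixOrder Matrix in
theorem IsEffect.norm_le {n : ℕ} {E : Matrix (Fin n) (Fin n) ℂ} (h : IsEffect E) : ‖E‖ ≤ 1 := by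
  have h0 : 0 ≤ E := Matrix.nonneg_iff_posSemidef.2 h.1
  have h1 : E ≤ 1 := Matrix.le_iff.2 h.2
  exact (CStarAlgebra.norm_le_one_iff_of_nonneg E h0).2 h1

open scoped Matrix.Norms.L2Operator Matrix in
theorem l2_opNorm_le_one_of_isometry {m n : Type} [Fintype m] [Fintype n] [DecidableEq n]
    {V : Matrix m n ℂ} (h : Vᴴ * V = 1) : ‖V‖ ≤ 1 := by
  have h1 := Matrix.l2_opNorm_conjTranspose_mul_self V
  have h2 : ‖(1 : Matrix n n ℂ)‖ ≤ 1 := by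
    rw [← Matrix.diagonal_one, Matrix.l2_opNorm_diagonal]
    exact (pi_norm_le_iff_of_nonneg zero_le_one).2 fun i => by simp
  rw [h] at h1
  nlinarith [norm_nonneg V]

-- Selecting rows and columns along injections is compression between two coordinate isometries.
-- This keeps the blocks cut out by a message qubit contractive.
open scoped Matrix.Norms.L2Operator Matrix in
theorem l2_opNorm_submatrix_le {m m' n n' : Type} [Fintype m] [Fintype n] [Fintype m'] [Fintype n']
    [DecidableEq m] [DecidableEq n] [DecidableEq m'] [DecidableEq n'] (A : Matrix m n ℂ)
    {e : m' → m} (he : Function.Injective e) {g : n' → n} (hg : Function.Injective g) :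
    ‖A.submatrix e g‖ ≤ ‖A‖ := by
  have hJ : ∀ {p p' : Type} [Fintype p] [Fintype p'] [DecidableEq p] [DecidableEq p']
      {e : p' → p}, Function.Injective e →
      ‖((1 : Matrix p p ℂ).submatrix id e)‖ ≤ 1 := by
    intro p p' _ _ _ _ e he
    refine l2_opNorm_le_one_of_isometry ?_
    rw [Matrix.conjTranspose_submatrix, Matrix.conjTranspose_one,
      ← Matrix.submatrix_mul _ _ _ id _ Function.bijective_id, one_mul, Matrix.submatrix_one _ he]
  have h : A.submatrix e g = ((1 : Matrix m m ℂ).submatrix id e)ᴴ * A *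
      (1 : Matrix n n ℂ).submatrix id g := by
    ext i j
    simp [Matrix.mul_apply, Matrix.one_apply]
  rw [h]
  refine (Matrix.l2_opNorm_mul _ _).trans ?_
  refine (mul_le_mul (Matrix.l2_opNorm_mul _ _) le_rfl (norm_nonneg _) (by positivity)).trans ?_
  rw [Matrix.l2_opNorm_conjTranspose]
  have h1 := hJ he
  have h2 := hJ hg
  calc _ ≤ 1 * ‖A‖ * 1 := by gcongr
    _ = _ := by ring

open scoped Matrix.Norms.L2Operator Matrix in
theorem sum_norm_sq_mul_le {a b : ℕ} {A : Matrix (Fin a) (Fin a) ℂ} (hA : ‖A‖ ≤ 1)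
    (B : Matrix (Fin a) (Fin b) ℂ) :
    ∑ i, ∑ j, ‖(A * B) i j‖ ^ 2 ≤ ∑ i, ∑ j, ‖B i j‖ ^ 2 := by
  rw [Finset.sum_comm, Finset.sum_comm (f := fun i j => ‖B i j‖ ^ 2)]
  refine Finset.sum_le_sum fun j _ => ?_
  have h := Matrix.l2_opNorm_mulVec A (WithLp.toLp 2 fun i => B i j)
  have h' : ‖WithLp.toLp 2 (A *ᵥ fun i => B i j)‖ ≤ ‖WithLp.toLp 2 fun i => B i j‖ :=
    h.trans (mul_le_of_le_one_left (norm_nonneg _) hA)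
  have h2 := pow_le_pow_left₀ (norm_nonneg _) h' 2
  rw [EuclideanSpace.norm_sq_eq, EuclideanSpace.norm_sq_eq] at h2
  exact h2

-- The source of the factor 4 per qubit: the received qubit takes a value in the ket and another in
-- the bra, and each of the four pairs selects one block of `B`.
open scoped Matrix in
theorem mul_mul_conjTranspose_eq_sum {p : Type} {b : ℕ} (Φ : Fin 2 → Matrix p (Fin b) ℂ)
    (Ψ : Matrix p (Fin (b * 2)) ℂ) (hΨ : ∀ i j c, Ψ i (finProdFinEquiv (j, c)) = Φ c i j)
    (B : Matrix (Fin (b * 2)) (Fin (b * 2)) ℂ) :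
    Ψ * B * Ψᴴ = ∑ z : Fin 2 × Fin 2, Φ z.1 * B.submatrix (fun j => finProdFinEquiv (j, z.1))
      (fun j => finProdFinEquiv (j, z.2)) * (Φ z.2)ᴴ := by
  ext i i'
  simp only [Matrix.sum_apply, Matrix.mul_apply, Matrix.conjTranspose_apply,
    ← finProdFinEquiv.sum_comp, Fintype.sum_prod_type, hΨ, Matrix.submatrix_apply,
    Fin.sum_univ_two, Finset.sum_add_distrib, add_mul]
  ring

open scoped Matrix.Norms.L2Operator Matrix in
/-- The acceptance probability as a sum of at most `4 ^ q` terms, in each of which Alice and Bob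
apply contractions to the initial state. -/
theorem Interaction.acceptProb_eq_sum {X Y : Type} {a b q : ℕ} (I : Interaction X Y a b q) :
    ∃ (T : Type) (_ : Fintype T) (A : T → X → Matrix (Fin a) (Fin a) ℂ)
      (B : T → Y → Matrix (Fin b) (Fin b) ℂ), Fintype.card T = 4 ^ q ∧
      (∀ t x, ‖A t x‖ ≤ 1) ∧ (∀ t y, ‖B t y‖ ≤ 1) ∧
      ∀ x y Ψ, I.acceptProb x y Ψ = (∑ t, (A t x * Ψ * B t y * Ψᴴ).trace).re := by
  induction I with
  | @outA a b E hE =>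
    refine ⟨Unit, inferInstance, fun _ => E, fun _ _ => 1, by simp, fun _ x => (hE x).norm_le,
      fun _ _ => l2_opNorm_le_one_of_isometry (by simp), fun x y Ψ => ?_⟩
    simp only [Interaction.acceptProb, Finset.univ_unique, Finset.sum_singleton, Matrix.mul_one]
    rw [Matrix.mul_assoc, Matrix.trace_mul_comm]
  | @outB a b E hE =>
    refine ⟨Unit, inferInstance, fun _ _ => 1, fun _ y => (E y)ᵀ, by simp,
      fun _ _ => l2_opNorm_le_one_of_isometry (by simp), fun _ y => ?_, fun x y Ψ => ?_⟩
    · refine IsEffect.norm_le ⟨(hE y).1.transpose, ?_⟩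
      have := (hE y).2.transpose
      rwa [Matrix.transpose_sub, Matrix.transpose_one] at this
    · simp only [Interaction.acceptProb, Finset.univ_unique, Finset.sum_singleton, Matrix.one_mul]
  | @sendA a b q a' V hV rest ih =>
    obtain ⟨T, _, A, B, hT, hA, hB, h⟩ := ih
    let e : Fin 2 → Fin a' → Fin a' × Fin 2 := fun c i => (i, c)
    have he : ∀ c, Function.Injective (e c) := fun c i j h => (Prod.mk.inj h).1
    let g : Fin 2 → Fin b → Fin (b * 2) := fun c j => finProdFinEquiv (j, c)
    have hg : ∀ c, Function.Injective (g c) := fun c i j h =>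
      (Prod.mk.inj (finProdFinEquiv.injective h)).1
    -- For message values c in the ket and c' in the bra, Alice's operator becomes V_c'† A V_c and
    -- Bob's becomes the (c, c') block of B.
    refine ⟨T × Fin 2 × Fin 2, inferInstance,
      fun t x => ((V x).submatrix (e t.2.2) id)ᴴ * A t.1 x * (V x).submatrix (e t.2.1) id,
      fun t y => (B t.1 y).submatrix (g t.2.1) (g t.2.2), ?_, ?_, ?_, ?_⟩
    · simp [hT]; ring
    · intro t x
      have hVn : ∀ c, ‖(V x).submatrix (e c) id‖ ≤ 1 := fun c =>
        (l2_opNorm_submatrix_le _ (he c) Function.injective_id).trans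
          (l2_opNorm_le_one_of_isometry (hV x))
      refine (Matrix.l2_opNorm_mul _ _).trans ?_
      refine mul_le_one₀ ((Matrix.l2_opNorm_mul _ _).trans ?_) (norm_nonneg _) (hVn _)
      refine mul_le_one₀ ?_ (norm_nonneg _) (hA _ _)
      rw [Matrix.l2_opNorm_conjTranspose]
      exact hVn _
    · exact fun t y => (l2_opNorm_submatrix_le _ (hg _) (hg _)).trans (hB _ _)
    · intro x y Ψ
      simp only [Interaction.acceptProb]
      rw [h, Fintype.sum_prod_type]
      refine congrArg Complex.re (Finset.sum_congr rfl fun t _ => ?_)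
      rw [Matrix.mul_assoc, Matrix.mul_assoc, ← Matrix.mul_assoc _ (B t y),
        mul_mul_conjTranspose_eq_sum (fun c => (V x).submatrix (e c) id * Ψ)]
      · rw [Matrix.mul_sum, Matrix.trace_sum]
        refine Finset.sum_congr rfl fun z _ => ?_
        simp only [Matrix.conjTranspose_mul, ← Matrix.mul_assoc]
        rw [Matrix.trace_mul_comm]
        simp only [← Matrix.mul_assoc]
        rfl
      · intro i j c
        simp only [transferA, Matrix.of_apply, Equiv.symm_apply_apply]
        rfl
  | @sendB a b q b' V hV rest ih =>
    obtain ⟨T, _, A, B, hT, hA, hB, h⟩ := ih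
    let e : Fin 2 → Fin b' → Fin b' × Fin 2 := fun c i => (i, c)
    have he : ∀ c, Function.Injective (e c) := fun c i j h => (Prod.mk.inj h).1
    let g : Fin 2 → Fin a → Fin (a * 2) := fun c j => finProdFinEquiv (j, c)
    have hg : ∀ c, Function.Injective (g c) := fun c i j h =>
      (Prod.mk.inj (finProdFinEquiv.injective h)).1
    -- Bob acts by the transpose of V on the right, so on the adjoint of the joint state he acts on
    -- the left by the entrywise conjugate of V. This reduces his send to the computation for
    -- Alice's.
    let U : Y → Matrix (Fin b' × Fin 2) (Fin b) ℂ := fun y => (V y)ᵀᴴ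
    have hU : ∀ y, (U y)ᴴ * U y = 1 := fun y => by
      have := congrArg Matrix.transpose (hV y)
      rw [Matrix.transpose_mul, Matrix.transpose_one] at this
      have h2 := congrArg Matrix.conjTranspose this
      rw [Matrix.conjTranspose_mul, Matrix.conjTranspose_one] at h2
      rw [← this]
      simp only [U, Matrix.conjTranspose_conjTranspose]
      rfl
    refine ⟨T × Fin 2 × Fin 2, inferInstance,
      fun t x => (A t.1 x).submatrix (g t.2.1) (g t.2.2),
      fun t y => ((U y).submatrix (e t.2.2) id)ᴴ * B t.1 y * (U y).submatrix (e t.2.1) id,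
      ?_, ?_, ?_, ?_⟩
    · simp [hT]; ring
    · exact fun t y => (l2_opNorm_submatrix_le _ (hg _) (hg _)).trans (hA _ _)
    · intro t x
      have hVn : ∀ c, ‖(U x).submatrix (e c) id‖ ≤ 1 := fun c =>
        (l2_opNorm_submatrix_le _ (he c) Function.injective_id).trans
          (l2_opNorm_le_one_of_isometry (hU x))
      refine (Matrix.l2_opNorm_mul _ _).trans ?_
      refine mul_le_one₀ ((Matrix.l2_opNorm_mul _ _).trans ?_) (norm_nonneg _) (hVn _)
      refine mul_le_one₀ ?_ (norm_nonneg _) (hB _ _)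
      rw [Matrix.l2_opNorm_conjTranspose]
      exact hVn _
    · intro x y Ψ
      simp only [Interaction.acceptProb]
      rw [h, Fintype.sum_prod_type]
      refine congrArg Complex.re (Finset.sum_congr rfl fun t _ => ?_)
      rw [Matrix.mul_assoc, Matrix.trace_mul_comm, Matrix.mul_assoc]
      have hkey := mul_mul_conjTranspose_eq_sum (fun c => (U y).submatrix (e c) id * Ψᴴ)
        (transferB (V y) Ψ)ᴴ ?_ (A t x)
      · rw [Matrix.conjTranspose_conjTranspose, Matrix.mul_assoc] at hkey
        rw [hkey, Matrix.mul_sum, Matrix.trace_sum]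
        refine Finset.sum_congr rfl fun z _ => ?_
        simp only [Matrix.conjTranspose_mul, Matrix.conjTranspose_conjTranspose, Matrix.mul_assoc]
        rw [← Matrix.mul_assoc, ← Matrix.mul_assoc, Matrix.trace_mul_comm]
        simp only [Matrix.mul_assoc]
        rfl
      · intro i j c
        simp only [transferB, Matrix.of_apply, Equiv.symm_apply_apply, Matrix.conjTranspose_apply]
        simp [Matrix.mul_apply, e, U, mul_comm]

open scoped Matrix in
theorem trace_mul_mul_mul_conjTranspose_re {a b : ℕ} (A : Matrix (Fin a) (Fin a) ℂ)
    (B : Matrix (Fin b) (Fin b) ℂ) (Ψ : Matrix (Fin a) (Fin b) ℂ) :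
    (A * Ψ * B * Ψᴴ).trace.re = ∑ i, ∑ j, ((A * Ψ) i j).re * ((B * Ψᴴ) j i).re
      + ∑ i, ∑ j, ((A * Ψ) i j).im * (-((B * Ψᴴ) j i).im) := by
  rw [Matrix.mul_assoc, Matrix.trace, Complex.re_sum, ← Finset.sum_add_distrib]
  refine Finset.sum_congr rfl fun i _ => ?_
  rw [Matrix.diag_apply, Matrix.mul_apply, Complex.re_sum, ← Finset.sum_add_distrib]
  refine Finset.sum_congr rfl fun j _ => ?_
  rw [Complex.mul_re]; ring

open scoped Matrix.Norms.L2Operator Matrix in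
/-- The acceptance probability of a `q`-qubit protocol with entanglement is an inner product of
real vectors, one depending on Alice's input and one on Bob's, of squared norm at most `4 ^ q`. -/
theorem EntProtocol.acceptProb_eq_inner {X Y : Type} {q : ℕ} (P : EntProtocol X Y q) :
    ∃ (N : ℕ) (u : X → Fin N → ℝ) (v : Y → Fin N → ℝ),
      (∀ x, ∑ k, u x k ^ 2 ≤ 4 ^ q) ∧ (∀ y, ∑ k, v y k ^ 2 ≤ 4 ^ q) ∧
      ∀ x y, P.acceptProb x y = ∑ k, u x k * v y k := by
  obtain ⟨T, _, A, B, hT, hA, hB, h⟩ := P.run.acceptProb_eq_sum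
  -- The last factor separates real and imaginary parts; the minus sign of Re(zw) = Re z Re w - Im z
  -- Im w is put into `v`.
  let K := (T × Fin P.a × Fin P.b) × Fin 2
  let u : X → K → ℝ := fun x k => if k.2 = 0 then ((A k.1.1 x * P.Ψ) k.1.2.1 k.1.2.2).re
    else ((A k.1.1 x * P.Ψ) k.1.2.1 k.1.2.2).im
  let v : Y → K → ℝ := fun x k => if k.2 = 0 then ((B k.1.1 x * P.Ψᴴ) k.1.2.2 k.1.2.1).re
    else -((B k.1.1 x * P.Ψᴴ) k.1.2.2 k.1.2.1).im
  have hsq : ∀ z : ℂ, z.re * z.re + z.im * z.im = ‖z‖ ^ 2 := fun z => by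
    rw [← Complex.normSq_apply, Complex.normSq_eq_norm_sq]
  have hcard : ∀ F : T → ℝ, (∀ t, F t ≤ 1) → ∑ t, F t ≤ 4 ^ q := fun F hF => by
    refine (Finset.sum_le_sum fun t _ => hF t).trans ?_
    simp [hT]
  have hu : ∀ x, ∑ k, u x k ^ 2 ≤ 4 ^ q := by
    intro x
    simp only [K, u, Fintype.sum_prod_type, Fin.sum_univ_two]
    refine hcard _ fun t => ?_
    refine le_trans (le_of_eq ?_) ((sum_norm_sq_mul_le (hA t x) P.Ψ).trans_eq P.unit)
    refine Finset.sum_congr rfl fun i _ => Finset.sum_congr rfl fun j _ => ?_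
    simp [← hsq, pow_two]
  have hv : ∀ x, ∑ k, v x k ^ 2 ≤ 4 ^ q := by
    intro x
    simp only [K, v, Fintype.sum_prod_type, Fin.sum_univ_two]
    refine hcard _ fun t => ?_
    refine le_trans (le_of_eq ?_) ((sum_norm_sq_mul_le (hB t x) P.Ψᴴ).trans_eq ?_)
    · rw [Finset.sum_comm]
      refine Finset.sum_congr rfl fun i _ => Finset.sum_congr rfl fun j _ => ?_
      simp [← hsq, pow_two]
    · rw [Finset.sum_comm, ← P.unit]
      simp
  have huv : ∀ x y, P.acceptProb x y = ∑ k, u x k * v y k := by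
    intro x y
    rw [EntProtocol.acceptProb, h, Complex.re_sum]
    simp only [K, u, v, Fintype.sum_prod_type, Fin.sum_univ_two]
    refine Finset.sum_congr rfl fun t _ => ?_
    rw [trace_mul_mul_mul_conjTranspose_re]
    simp [Finset.sum_add_distrib]
  let eq := Fintype.equivFin K
  refine ⟨Fintype.card K, fun x k => u x (eq.symm k), fun y k => v y (eq.symm k), fun x => ?_,
    fun y => ?_, fun x y => ?_⟩
  · rw [eq.symm.sum_comp (fun k => u x k ^ 2)]; exact hu x
  · rw [eq.symm.sum_comp (fun k => v y k ^ 2)]; exact hv y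
  · rw [eq.symm.sum_comp (fun k => u x k * v y k)]; exact huv x y

/-! ### Chernoff bounds -/

/-- Chernoff bound for the sum of `d` independent samples of a bounded function on a finite
probability space. -/
theorem chernoff_upper {S : Type} [Fintype S] (w : S → ℝ) (hw : ∀ s, 0 ≤ w s)
    (hw1 : ∑ s, w s = 1) (Z : S → ℝ) (μ b t : ℝ) (hμ : ∑ s, w s * Z s = μ) (hb : 0 < b)
    (hZ : ∀ s, |Z s - μ| ≤ b) (ht : 0 ≤ t) (htb : t ≤ 2 * b) (d : ℕ) :
    ∑ o : Fin d → S, (if d * (μ + t) ≤ ∑ i, Z (o i) then ∏ i, w (o i) else 0)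
      ≤ Real.exp (-(d * t ^ 2 / (4 * b ^ 2))) := by
  -- The minimiser of l²b² - lt. The assumption t ≤ 2b gives lb ≤ 1, the range in which e^z ≤ 1 + z
  -- + z² is used.
  set l : ℝ := t / (2 * b ^ 2) with hl
  have hl0 : 0 ≤ l := by positivity
  have hlb : l * b ≤ 1 := by
    rw [hl, div_mul_eq_mul_div, div_le_one (by positivity)]; nlinarith
  have h1 : ∑ s, w s * Real.exp (l * (Z s - μ)) ≤ Real.exp (l ^ 2 * b ^ 2) := by
    calc ∑ s, w s * Real.exp (l * (Z s - μ))
        ≤ ∑ s, w s * (1 + l * (Z s - μ) + l ^ 2 * b ^ 2) := by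
          refine Finset.sum_le_sum fun s _ => mul_le_mul_of_nonneg_left ?_ (hw s)
          have ha : |l * (Z s - μ)| ≤ l * b := by
            rw [abs_mul, abs_of_nonneg hl0]; exact mul_le_mul_of_nonneg_left (hZ s) hl0
          have h := Real.abs_exp_sub_one_sub_id_le (ha.trans hlb)
          have h' := (abs_le.1 h).2
          have : (l * (Z s - μ)) ^ 2 ≤ (l * b) ^ 2 := by
            rw [← sq_abs]; exact pow_le_pow_left₀ (abs_nonneg _) ha 2
          nlinarith
      _ = 1 + l ^ 2 * b ^ 2 := by
          have : ∀ s, w s * (1 + l * (Z s - μ) + l ^ 2 * b ^ 2)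
              = w s * (1 - l * μ + l ^ 2 * b ^ 2) + l * (w s * Z s) := fun s => by ring
          simp_rw [this, Finset.sum_add_distrib, ← Finset.sum_mul, ← Finset.mul_sum, hw1, hμ]
          ring
      _ ≤ _ := by linarith [Real.add_one_le_exp (l ^ 2 * b ^ 2)]
  calc ∑ o : Fin d → S, (if d * (μ + t) ≤ ∑ i, Z (o i) then ∏ i, w (o i) else 0)
      ≤ ∑ o : Fin d → S, ∏ i, (w (o i) * Real.exp (l * (Z (o i) - μ)) * Real.exp (-(l * t))) := by
        -- Exponential Markov inequality: the indicator of the deviation is at most exp(l(ΣZ - d(μ +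
        -- t))), which factors over the samples.
        refine Finset.sum_le_sum fun o _ => ?_
        have h0 : 0 ≤ ∏ i, w (o i) := Finset.prod_nonneg fun i _ => hw _
        simp_rw [Finset.prod_mul_distrib, mul_assoc, ← Real.exp_sum]
        split_ifs with h
        · refine le_mul_of_one_le_right h0 ?_
          rw [← Real.exp_add]
          refine Real.one_le_exp ?_
          simp only [← Finset.mul_sum, Finset.sum_sub_distrib, Finset.sum_const,
            Finset.card_univ, Fintype.card_fin, nsmul_eq_mul]
          nlinarith
        · positivity
    _ = ((∑ s, w s * Real.exp (l * (Z s - μ))) * Real.exp (-(l * t))) ^ d := by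
        have := Finset.prod_univ_sum (fun _ : Fin d => (Finset.univ : Finset S))
          (fun _ s => w s * Real.exp (l * (Z s - μ)) * Real.exp (-(l * t)))
        rw [Fintype.piFinset_univ] at this
        rw [← this, ← Finset.sum_mul]
        simp
    _ ≤ (Real.exp (l ^ 2 * b ^ 2) * Real.exp (-(l * t))) ^ d := by
        refine pow_le_pow_left₀ ?_ (mul_le_mul_of_nonneg_right h1 (Real.exp_nonneg _)) d
        exact mul_nonneg (Finset.sum_nonneg fun s _ => mul_nonneg (hw s) (Real.exp_nonneg _))
          (Real.exp_nonneg _)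
    _ = _ := by
        rw [← Real.exp_add, ← Real.exp_nat_mul]
        congr 1
        rw [hl]; field_simp; ring

theorem chernoff_lower {S : Type} [Fintype S] (w : S → ℝ) (hw : ∀ s, 0 ≤ w s)
    (hw1 : ∑ s, w s = 1) (Z : S → ℝ) (μ b t : ℝ) (hμ : ∑ s, w s * Z s = μ) (hb : 0 < b)
    (hZ : ∀ s, |Z s - μ| ≤ b) (ht : 0 ≤ t) (htb : t ≤ 2 * b) (d : ℕ) :
    ∑ o : Fin d → S, (if ∑ i, Z (o i) ≤ d * (μ - t) then ∏ i, w (o i) else 0)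
      ≤ Real.exp (-(d * t ^ 2 / (4 * b ^ 2))) := by
  have h := chernoff_upper w hw hw1 (fun s => -Z s) (-μ) b t (by simp [hμ]) hb
    (fun s => by rw [neg_sub_neg, abs_sub_comm]; exact hZ s) ht htb d
  refine le_of_eq_of_le (Finset.sum_congr rfl fun o _ => ?_) h
  refine if_congr ?_ rfl rfl
  rw [Finset.sum_neg_distrib]
  constructor <;> intro h <;> linarith

theorem sum_prod_weights {S : Type} [Fintype S] (w : S → ℝ) (hw1 : ∑ s, w s = 1) (d : ℕ) :
    ∑ o : Fin d → S, ∏ i, w (o i) = 1 := by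
  have := Finset.prod_univ_sum (fun _ : Fin d => (Finset.univ : Finset S)) (fun _ s => w s)
  rw [Fintype.piFinset_univ] at this
  rw [← this]; simp [hw1]

/-! ## Random signs -/

def sgn (c : Bool) : ℝ := if c then 1 else -1

def signSum {N : ℕ} (a : Fin N → ℝ) (s : Fin N → Bool) : ℝ := ∑ i, a i * sgn (s i)

theorem sum_bool_fun_succ {N : ℕ} (F : (Fin (N + 1) → Bool) → ℝ) :
    ∑ s, F s = ∑ s : Fin N → Bool, (F (Fin.cons true s) + F (Fin.cons false s)) := by
  rw [← (Fin.consEquiv fun _ => Bool).sum_comp, Fintype.sum_prod_type]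
  simp only [Fintype.sum_bool, ← Finset.sum_add_distrib]
  rfl

theorem signSum_cons {N : ℕ} (a : Fin (N + 1) → ℝ) (c : Bool) (s : Fin N → Bool) :
    signSum a (Fin.cons c s) = a 0 * sgn c + signSum (fun i => a i.succ) s := by
  simp [signSum, Fin.sum_univ_succ]

/-- Random signs make a sign sum an unbiased one-coordinate sketch: terms linear in the first sign
cancel when both of its values are added. -/
theorem sum_signSum_mul {N : ℕ} (a b : Fin N → ℝ) :
    ∑ s, signSum a s * signSum b s = 2 ^ N * ∑ i, a i * b i := by
  induction N with
  | zero => simp [signSum]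
  | succ N ih =>
    have : ∀ s, signSum a (Fin.cons true s) * signSum b (Fin.cons true s)
        + signSum a (Fin.cons false s) * signSum b (Fin.cons false s)
        = 2 * (a 0 * b 0) + 2 * (signSum (fun i => a i.succ) s * signSum (fun i => b i.succ) s) := by
      intro s; simp only [signSum_cons, sgn]; simp; ring
    rw [sum_bool_fun_succ, Fin.sum_univ_succ]
    simp_rw [this, Finset.sum_add_distrib, ← Finset.mul_sum, ih]
    simp; ring

/-- Khintchine's inequality for the fourth moment, by peeling off one sign: odd powers cancel, and
3(a² + R)² has room for a⁴ + 6a²R + 3R². It controls the bias caused by truncation. -/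
theorem sum_signSum_pow_four {N : ℕ} (a : Fin N → ℝ) :
    ∑ s, signSum a s ^ 4 ≤ 2 ^ N * (3 * (∑ i, a i ^ 2) ^ 2) := by
  induction N with
  | zero => simp [signSum]
  | succ N ih =>
    have : ∀ s, signSum a (Fin.cons true s) ^ 4 + signSum a (Fin.cons false s) ^ 4
        = 2 * a 0 ^ 4 + 12 * a 0 ^ 2 * (signSum (fun i => a i.succ) s
          * signSum (fun i => a i.succ) s) + 2 * signSum (fun i => a i.succ) s ^ 4 := by
      intro s; simp only [signSum_cons, sgn]; simp; ring
    rw [sum_bool_fun_succ, Fin.sum_univ_succ]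
    simp_rw [this, Finset.sum_add_distrib, ← Finset.mul_sum, sum_signSum_mul]
    have h := ih (fun i => a i.succ)
    have hp : (0 : ℝ) ≤ 2 ^ N * a 0 ^ 4 := by positivity
    simp only [Finset.sum_const, Finset.card_univ, Fintype.card_fun, Fintype.card_bool,
      Fintype.card_fin, nsmul_eq_mul, ← pow_two]
    push_cast
    rw [pow_succ (2 : ℝ) N]
    nlinarith

/-- Truncation at level `T`, given through `T ^ 2`. -/
noncomputable def trunc (T2 x : ℝ) : ℝ := if x ^ 2 ≤ T2 then x else 0

theorem trunc_sq_le {T2 : ℝ} (hT : 0 ≤ T2) (x : ℝ) : trunc T2 x ^ 2 ≤ T2 := by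
  unfold trunc; split_ifs with h
  · exact h
  · simpa using hT

theorem abs_trunc_mul_le {T2 : ℝ} (hT : 0 ≤ T2) (x y : ℝ) : |trunc T2 x * trunc T2 y| ≤ T2 := by
  have hx := trunc_sq_le hT x
  have hy := trunc_sq_le hT y
  rw [abs_le]
  constructor <;> nlinarith [sq_nonneg (trunc T2 x - trunc T2 y), sq_nonneg (trunc T2 x + trunc T2 y)]

/-- If a factor is cut off, then x² + y² ≥ T2, so |xy| ≤ (x² + y²)/2 may be multiplied by (x² +
y²)/T2 ≥ 1. -/
theorem abs_mul_sub_trunc_mul_le {T2 : ℝ} (hT : 0 < T2) (x y : ℝ) :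
    |x * y - trunc T2 x * trunc T2 y| ≤ (x ^ 4 + y ^ 4) / T2 := by
  by_cases h : x ^ 2 ≤ T2 ∧ y ^ 2 ≤ T2
  · simp only [trunc, h.1, h.2, if_true, sub_self, abs_zero]; positivity
  · have h0 : trunc T2 x * trunc T2 y = 0 := by
      unfold trunc
      rcases not_and_or.1 h with h | h <;> simp [h]
    have h1 : T2 ≤ x ^ 2 + y ^ 2 := by
      rcases not_and_or.1 h with h | h <;> nlinarith [sq_nonneg x, sq_nonneg y]
    rw [h0, sub_zero, le_div_iff₀ hT]
    have h2 : |x * y| ≤ (x ^ 2 + y ^ 2) / 2 := by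
      rw [abs_le]; constructor <;> nlinarith [sq_nonneg (x - y), sq_nonneg (x + y)]
    calc |x * y| * T2 ≤ (x ^ 2 + y ^ 2) / 2 * (x ^ 2 + y ^ 2) := by gcongr
      _ ≤ _ := by nlinarith [sq_nonneg (x ^ 2 - y ^ 2)]

theorem le_sum_sum {I : Type} [Fintype I] (g : I → I → ℝ) (hg : ∀ i j, 0 ≤ g i j) (i j : I) :
    g i j ≤ ∑ i, ∑ j, g i j :=
  (Finset.single_le_sum (f := fun j => g i j) (fun j _ => hg i j) (Finset.mem_univ j)).trans
    (Finset.single_le_sum (f := fun i => ∑ j, g i j)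
      (fun i _ => Finset.sum_nonneg fun j _ => hg i j) (Finset.mem_univ i))

/-! ### Dimension reduction -/

/-- Dimension reduction: finitely many vectors of norm at most one can be mapped to `ℝ^d`
with all inner products preserved up to `ε`. -/
theorem exists_dimension_reduction {I : Type} [Fintype I] {N : ℕ} (a : I → Fin N → ℝ)
    (ha : ∀ i, ∑ k, a i k ^ 2 ≤ 1) (ε : ℝ) (hε : 0 < ε) (hε1 : ε ≤ 1) (d : ℕ) (hd : 0 < d)
    (hcard : 2 * (Fintype.card I : ℝ) ^ 2 < Real.exp (d * ε ^ 4 / 9216)) :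
    ∃ φ : I → Fin d → ℝ, ∀ i j, |∑ k, φ i k * φ j k - ∑ k, a i k * a j k| ≤ ε := by
  -- Chosen so that the truncation bias, at most (3 + 3)/T2 by the fourth moments, is ε/2; the other
  -- ε/2 is left for sampling.
  set T2 : ℝ := 12 / ε with hT2
  have hT : 0 < T2 := by positivity
  let X : I → (Fin N → Bool) → ℝ := fun i s => trunc T2 (signSum (a i) s)
  let w : (Fin N → Bool) → ℝ := fun _ => (2 ^ N)⁻¹
  have hw : ∀ s, 0 ≤ w s := fun s => by positivity
  have hw1 : ∑ s, w s = 1 := by simp [w]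
  let μ : I → I → ℝ := fun i j => ∑ s, w s * (X i s * X j s)
  have hμ : ∀ i j, |μ i j - ∑ k, a i k * a j k| ≤ ε / 2 := by
    intro i j
    have h4 : ∀ i, ∑ s, w s * signSum (a i) s ^ 4 ≤ 3 := by
      intro i
      rw [← Finset.mul_sum, inv_mul_le_iff₀ (by positivity)]
      refine (sum_signSum_pow_four (a i)).trans ?_
      have h0 : 0 ≤ ∑ k, a i k ^ 2 := Finset.sum_nonneg fun k _ => sq_nonneg _
      have : (∑ k, a i k ^ 2) ^ 2 ≤ 1 := by nlinarith [ha i]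
      gcongr; linarith
    have he : ∑ k, a i k * a j k = ∑ s, w s * (signSum (a i) s * signSum (a j) s) := by
      rw [← Finset.mul_sum, sum_signSum_mul, inv_mul_cancel_left₀ (by positivity)]
    rw [he, abs_sub_comm, ← Finset.sum_sub_distrib]
    calc |∑ s, (w s * (signSum (a i) s * signSum (a j) s) - w s * (X i s * X j s))|
        ≤ ∑ s, |w s * (signSum (a i) s * signSum (a j) s) - w s * (X i s * X j s)| :=
          Finset.abs_sum_le_sum_abs _ _
      _ ≤ ∑ s, w s * ((signSum (a i) s ^ 4 + signSum (a j) s ^ 4) / T2) := by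
          refine Finset.sum_le_sum fun s _ => ?_
          rw [← mul_sub, abs_mul, abs_of_nonneg (hw s)]
          exact mul_le_mul_of_nonneg_left (abs_mul_sub_trunc_mul_le hT _ _) (hw s)
      _ = (∑ s, w s * signSum (a i) s ^ 4 + ∑ s, w s * signSum (a j) s ^ 4) / T2 := by
          rw [← Finset.sum_add_distrib, Finset.sum_div]
          refine Finset.sum_congr rfl fun s _ => by ring
      _ ≤ (3 + 3) / T2 := by gcongr <;> exact h4 _
      _ = ε / 2 := by rw [hT2]; field_simp; norm_num
  have hμT : ∀ i j, |μ i j| ≤ T2 := by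
    intro i j
    calc |μ i j| ≤ ∑ s, |w s * (X i s * X j s)| := Finset.abs_sum_le_sum_abs _ _
      _ ≤ ∑ s, w s * T2 := by
          refine Finset.sum_le_sum fun s _ => ?_
          rw [abs_mul, abs_of_nonneg (hw s)]
          exact mul_le_mul_of_nonneg_left (abs_trunc_mul_le hT.le _ _) (hw s)
      _ = T2 := by rw [← Finset.sum_mul, hw1, one_mul]
  have hZ : ∀ i j s, |X i s * X j s - μ i j| ≤ 2 * T2 := fun i j s => by
    have h1 := abs_le.1 (hμT i j)
    have h2 := abs_le.1 (abs_trunc_mul_le hT.le (signSum (a i) s) (signSum (a j) s))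
    rw [abs_le]; constructor <;> simp only [X] <;> linarith
  have htb : ε / 2 ≤ 2 * (2 * T2) := by
    have : 12 ≤ T2 := by rw [hT2, le_div_iff₀ hε]; linarith
    linarith
  -- The fourth power arises because the range of the truncated products is itself of order 1/ε.
  -- This is harmless, as only log d counts as communication.
  have hexp : (d : ℝ) * (ε / 2) ^ 2 / (4 * (2 * T2) ^ 2) = d * ε ^ 4 / 9216 := by
    rw [hT2]; field_simp; norm_num
  have hU := fun i j => chernoff_upper w hw hw1 (fun s => X i s * X j s) (μ i j) (2 * T2) (ε / 2)
    rfl (by positivity) (hZ i j) (by positivity) htb d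
  have hL := fun i j => chernoff_lower w hw hw1 (fun s => X i s * X j s) (μ i j) (2 * T2) (ε / 2)
    rfl (by positivity) (hZ i j) (by positivity) htb d
  simp only [hexp] at hU hL
  -- Union bound over all pairs and both directions: if every sample failed, the total weight 1
  -- would be at most 2|I|² exp(-dε⁴/9216) < 1.
  obtain ⟨o, ho⟩ : ∃ o : Fin d → Fin N → Bool, ∀ i j,
      ∑ k, X i (o k) * X j (o k) < d * (μ i j + ε / 2) ∧
      d * (μ i j - ε / 2) < ∑ k, X i (o k) * X j (o k) := by
    by_contra! hcon
    have hsum : (1 : ℝ) ≤ ∑ _i : I, ∑ _j : I, (Real.exp (-(d * ε ^ 4 / 9216))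
        + Real.exp (-(d * ε ^ 4 / 9216))) := by
      calc (1 : ℝ) = ∑ o : Fin d → Fin N → Bool, ∏ k, w (o k) := (sum_prod_weights w hw1 d).symm
        _ ≤ ∑ o : Fin d → Fin N → Bool, ∑ i, ∑ j,
            ((if d * (μ i j + ε / 2) ≤ ∑ k, X i (o k) * X j (o k) then ∏ k, w (o k) else 0) +
            (if ∑ k, X i (o k) * X j (o k) ≤ d * (μ i j - ε / 2) then ∏ k, w (o k) else 0)) := by
            refine Finset.sum_le_sum fun o _ => ?_
            have h0 : 0 ≤ ∏ k, w (o k) := Finset.prod_nonneg fun k _ => hw (o k)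
            have hnn : ∀ i j, 0 ≤
              ((if d * (μ i j + ε / 2) ≤ ∑ k, X i (o k) * X j (o k) then ∏ k, w (o k) else 0) +
              (if ∑ k, X i (o k) * X j (o k) ≤ d * (μ i j - ε / 2) then ∏ k, w (o k) else 0)) := by
              intro i j; split_ifs <;> linarith
            obtain ⟨i, j, hij⟩ := hcon o
            refine le_trans ?_ (le_sum_sum _ hnn i j)
            by_cases h : d * (μ i j + ε / 2) ≤ ∑ k, X i (o k) * X j (o k)
            · rw [if_pos h]; split_ifs <;> linarith
            · rw [if_neg h, if_pos (hij (not_le.1 h)), zero_add]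
        _ = ∑ i, ∑ j, ∑ o : Fin d → Fin N → Bool,
            ((if d * (μ i j + ε / 2) ≤ ∑ k, X i (o k) * X j (o k) then ∏ k, w (o k) else 0) +
            (if ∑ k, X i (o k) * X j (o k) ≤ d * (μ i j - ε / 2) then ∏ k, w (o k) else 0)) := by
            rw [Finset.sum_comm]
            exact Finset.sum_congr rfl fun i _ => Finset.sum_comm
        _ ≤ _ := by
            refine Finset.sum_le_sum fun i _ => Finset.sum_le_sum fun j _ => ?_
            rw [Finset.sum_add_distrib]
            exact add_le_add (hU i j) (hL i j)
    simp only [Finset.sum_const, Finset.card_univ, nsmul_eq_mul, Real.exp_neg] at hsum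
    have hE := Real.exp_pos (d * ε ^ 4 / 9216)
    have : 2 * (Fintype.card I : ℝ) ^ 2 * (Real.exp (d * ε ^ 4 / 9216))⁻¹ < 1 := by
      rwa [← div_eq_mul_inv, div_lt_one hE]
    nlinarith
  have hd' : (0 : ℝ) < d := by exact_mod_cast hd
  refine ⟨fun i k => X i (o k) / Real.sqrt d, fun i j => ?_⟩
  have hs : ∑ k, X i (o k) / Real.sqrt d * (X j (o k) / Real.sqrt d)
      = (∑ k, X i (o k) * X j (o k)) / d := by
    rw [Finset.sum_div]
    refine Finset.sum_congr rfl fun k _ => ?_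
    rw [div_mul_div_comm, Real.mul_self_sqrt hd'.le]
  rw [hs]
  have h1 : (∑ k, X i (o k) * X j (o k)) / d < μ i j + ε / 2 := by
    rw [div_lt_iff₀ hd', mul_comm]; exact (ho i j).1
  have h2 : μ i j - ε / 2 < (∑ k, X i (o k) * X j (o k)) / d := by
    rw [lt_div_iff₀ hd', mul_comm]; exact (ho i j).2
  have h3 := abs_le.1 (hμ i j)
  rw [abs_le]; constructor <;> linarith

/-! ### Threshold decisions from repeated trials -/

/-- The probability that at least `T` of `r` independent trials succeed. -/
noncomputable def tailProb (r T : ℕ) (p : ℝ) : ℝ :=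
  ∑ o : Fin r → Fin 2,
    if T ≤ (Finset.univ.filter fun i => o i = 0).card then
      ∏ i, (if o i = 0 then p else 1 - p)
    else 0

theorem card_filter_eq_sum {r : ℕ} (o : Fin r → Fin 2) :
    ((Finset.univ.filter fun i => o i = 0).card : ℝ) = ∑ i, if o i = 0 then (1 : ℝ) else 0 := by
  simp

theorem exp_neg_two_le : Real.exp (-2) ≤ 1 / 3 := by
  rw [Real.exp_neg, one_div]
  have : (2 : ℝ) + 1 ≤ Real.exp 2 := Real.add_one_le_exp 2
  gcongr
  linarith

/-- The number of trials makes the exponent rδ²/4 at least 2, and e² ≥ 3. -/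
theorem chernoff_exponent {r : ℕ} {δ : ℝ} (hδ : 0 < δ) (hr : 8 / δ ^ 2 ≤ r) :
    Real.exp (-(r * δ ^ 2 / (4 * 1 ^ 2))) ≤ 1 / 3 := by
  refine le_trans (Real.exp_le_exp.2 ?_) exp_neg_two_le
  rw [div_le_iff₀ (by positivity)] at hr
  linarith

theorem tailProb_le {r : ℕ} {p m δ : ℝ} (hp0 : 0 ≤ p) (hp1 : p ≤ 1) (hδ : 0 < δ) (hδ1 : δ ≤ 1)
    (hr : 8 / δ ^ 2 ≤ r) (hp : p + δ ≤ m) : tailProb r ⌈r * m⌉₊ p ≤ 1 / 3 := by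
  have h := chernoff_upper (fun s : Fin 2 => if s = 0 then p else 1 - p)
    (fun s => by split_ifs <;> linarith) (by simp)
    (fun s => if s = 0 then 1 else 0) p 1 δ (by simp) one_pos
    (fun s => by rw [abs_le]; split_ifs <;> constructor <;> linarith) hδ.le (by linarith) r
  refine le_trans (Finset.sum_le_sum fun o _ => ?_) (h.trans (chernoff_exponent hδ hr))
  have h0 : 0 ≤ ∏ i, (if o i = 0 then p else 1 - p) :=
    Finset.prod_nonneg fun i _ => by split_ifs <;> linarith
  rw [← card_filter_eq_sum]
  by_cases hT : ⌈r * m⌉₊ ≤ (Finset.univ.filter fun i => o i = 0).card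
  · rw [if_pos hT, if_pos]
    exact le_trans (by gcongr) (Nat.ceil_le.1 hT)
  · rw [if_neg hT]; split_ifs <;> linarith

theorem le_tailProb {r : ℕ} {p m δ : ℝ} (hp0 : 0 ≤ p) (hp1 : p ≤ 1) (hδ : 0 < δ) (hδ1 : δ ≤ 1)
    (hr : 8 / δ ^ 2 ≤ r) (hp : m ≤ p - δ) : 2 / 3 ≤ tailProb r ⌈r * m⌉₊ p := by
  have hw1 : ∑ s : Fin 2, (if s = 0 then p else 1 - p) = 1 := by simp
  have h := chernoff_lower (fun s : Fin 2 => if s = 0 then p else 1 - p)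
    (fun s => by split_ifs <;> linarith) hw1
    (fun s => if s = 0 then 1 else 0) p 1 δ (by simp) one_pos
    (fun s => by rw [abs_le]; split_ifs <;> constructor <;> linarith) hδ.le (by linarith) r
  have h' := h.trans (chernoff_exponent hδ hr)
  have hsum := sum_prod_weights _ hw1 r
  suffices 1 ≤ tailProb r ⌈r * m⌉₊ p + 1 / 3 by linarith
  refine le_trans ?_ (add_le_add_right h' _)
  refine hsum.symm.trans_le ?_
  rw [tailProb, ← Finset.sum_add_distrib]
  refine Finset.sum_le_sum fun o _ => ?_
  have h0 : 0 ≤ ∏ i, (if o i = 0 then p else 1 - p) :=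
    Finset.prod_nonneg fun i _ => by split_ifs <;> linarith
  rw [← card_filter_eq_sum]
  by_cases hT : ⌈r * m⌉₊ ≤ (Finset.univ.filter fun i => o i = 0).card
  · rw [if_pos hT]; split_ifs <;> linarith
  · rw [if_neg hT, if_pos, zero_add]
    exact (Nat.lt_ceil.1 (not_le.1 hT)).le.trans (by gcongr)

/-! ### Fingerprints from protocols -/

/-- Real vectors of squared norm at most two can be turned into unit vectors with inner products
`1 / 2 + ⟨φ x, ψ y⟩ / 4`. -/
theorem exists_unit_vectors {X Y : Type} {d m : ℕ} (hm : d + 3 = m) (φ : X → Fin d → ℝ)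
    (ψ : Y → Fin d → ℝ) (hφ : ∀ x, ∑ k, φ x k * φ x k ≤ 2) (hψ : ∀ y, ∑ k, ψ y k * ψ y k ≤ 2) :
    ∃ (α : X → EuclideanSpace ℂ (Fin m)) (β : Y → EuclideanSpace ℂ (Fin m)),
      (∀ x, ‖α x‖ = 1) ∧ (∀ y, ‖β y‖ = 1) ∧
      ∀ x y, ‖inner ℂ (α x) (β y)‖ ^ 2 = (1 / 2 + (∑ k, φ x k * ψ y k) / 4) ^ 2 := by
  let e : Fin d ⊕ Fin 3 ≃ Fin m := finSumFinEquiv.trans (finCongr hm)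
  -- The first extra coordinate is shared and contributes the offset 1/2; the other two fill up the
  -- norms on disjoint coordinates, so they do not affect the overlap.
  let A : X → Fin d ⊕ Fin 3 → ℝ := fun x => Sum.elim (fun k => φ x k / 2)
    ![√(1 / 2), √(1 / 2 - (∑ k, φ x k * φ x k) / 4), 0]
  let B : Y → Fin d ⊕ Fin 3 → ℝ := fun y => Sum.elim (fun k => ψ y k / 2)
    ![√(1 / 2), 0, √(1 / 2 - (∑ k, ψ y k * ψ y k) / 4)]
  have hs : √(1 / 2) * √(1 / 2) = 1 / 2 := Real.mul_self_sqrt (by norm_num)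
  have hsum : ∀ φ ψ : Fin d → ℝ, ∑ k, φ k / 2 * (ψ k / 2) = (∑ k, φ k * ψ k) / 4 := fun φ ψ => by
    rw [Finset.sum_div]; exact Finset.sum_congr rfl fun k _ => by ring
  have hA : ∀ x, ∑ k, A x k * A x k = 1 := fun x => by
    simp only [A, Fintype.sum_sum_type, Sum.elim_inl, Sum.elim_inr, Fin.sum_univ_three,
      Matrix.cons_val, hs, hsum]
    rw [Real.mul_self_sqrt (by linarith [hφ x])]
    ring
  have hB : ∀ y, ∑ k, B y k * B y k = 1 := fun y => by
    simp only [B, Fintype.sum_sum_type, Sum.elim_inl, Sum.elim_inr, Fin.sum_univ_three,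
      Matrix.cons_val, hs, hsum]
    rw [Real.mul_self_sqrt (by linarith [hψ y])]
    ring
  have hAB : ∀ x y, ∑ k, A x k * B y k = 1 / 2 + (∑ k, φ x k * ψ y k) / 4 := fun x y => by
    simp only [A, B, Fintype.sum_sum_type, Sum.elim_inl, Sum.elim_inr, Fin.sum_univ_three,
      Matrix.cons_val, hs, hsum]
    ring
  have hnorm : ∀ a : Fin d ⊕ Fin 3 → ℝ, ∑ k, a k * a k = 1 →
      ‖(WithLp.toLp 2 fun k => (a (e.symm k) : ℂ) : EuclideanSpace ℂ (Fin m))‖ = 1 := by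
    intro a ha
    rw [EuclideanSpace.norm_eq, Real.sqrt_eq_one]
    simp only [Complex.norm_real, Real.norm_eq_abs, sq_abs]
    simp only [pow_two]
    rw [e.symm.sum_comp (fun k => a k * a k), ha]
  refine ⟨fun x => WithLp.toLp 2 fun k => (A x (e.symm k) : ℂ),
    fun y => WithLp.toLp 2 fun k => (B y (e.symm k) : ℂ), fun x => hnorm _ (hA x),
    fun y => hnorm _ (hB y), fun x y => ?_⟩
  have : inner ℂ (WithLp.toLp 2 fun k => (A x (e.symm k) : ℂ) : EuclideanSpace ℂ (Fin m))
      (WithLp.toLp 2 fun k => (B y (e.symm k) : ℂ))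
      = ((1 / 2 + (∑ k, φ x k * ψ y k) / 4 : ℝ) : ℂ) := by
    rw [← hAB, ← e.symm.sum_comp]
    simp [PiLp.inner_apply, mul_comm]
  rw [this, Complex.norm_real, Real.norm_eq_abs, sq_abs]

/-- Since 5 · 12⁴ · 9216 ≤ 2^30, the exponent is at least 5n, and 2^(5n) > 2^(2n+3) once n ≥ 2. -/
theorem two_mul_card_sq_lt_exp {n q d : ℕ} (hn : 2 ≤ n)
    (hd : (2 : ℝ) ^ (30 + 8 * q) * n ≤ d) :
    2 * ((2 : ℝ) ^ n + 2 ^ n) ^ 2 < Real.exp (d * (1 / (12 * 4 ^ q)) ^ 4 / 9216) := by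
  have h1 : (5 * n : ℝ) ≤ d * (1 / (12 * 4 ^ q)) ^ 4 / 9216 := by
    have h4 : ((4 : ℝ) ^ q) ^ 4 = 2 ^ (8 * q) := by
      rw [← pow_mul, show (4 : ℝ) = 2 ^ 2 by norm_num, ← pow_mul]; ring_nf
    rw [pow_add] at hd
    rw [div_pow, mul_pow, h4, one_pow, mul_one_div, div_div, le_div_iff₀ (by positivity)]
    refine le_trans ?_ hd
    have : (0 : ℝ) ≤ 2 ^ (8 * q) * n := by positivity
    norm_num
    nlinarith
  refine lt_of_lt_of_le ?_ (Real.exp_le_exp.2 h1)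
  have h2 : (2 : ℝ) ^ (5 * n) ≤ Real.exp (5 * n) := by
    have : Real.exp (5 * n) = Real.exp 1 ^ (5 * n) := by rw [← Real.exp_nat_mul]; push_cast; simp
    rw [this]
    have : (1 : ℝ) + 1 ≤ Real.exp 1 := Real.add_one_le_exp 1
    gcongr; linarith
  refine lt_of_lt_of_le ?_ h2
  have : 2 * ((2 : ℝ) ^ n + 2 ^ n) ^ 2 = 2 ^ (2 * n + 3) := by
    rw [pow_add, mul_comm 2 n, pow_mul]; ring
  rw [this]
  exact pow_lt_pow_right₀ (by norm_num) (by omega)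

theorem EntProtocol.exists_repeatedFingerprinting {n : ℕ} (hn : 2 ≤ n)
    {D : Set ((Fin n → Bool) × (Fin n → Bool))} {f : (Fin n → Bool) → (Fin n → Bool) → Bool}
    {q : ℕ} (P : EntProtocol (Fin n → Bool) (Fin n → Bool) q) (hP : BoundedError D f P.acceptProb) :
    ∃ F : RepeatedFingerprinting (Fin n → Bool) (Fin n → Bool) (31 + 8 * q + Nat.clog 2 n)
      (73728 * 2 ^ (4 * q)), BoundedError D f F.acceptProb := by
  obtain ⟨N, u, v, hu, hv, huv⟩ := P.acceptProb_eq_inner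
  set k := 31 + 8 * q + Nat.clog 2 n with hk
  set B : ℝ := 4 ^ q with hB
  have hB1 : 1 ≤ B := one_le_pow₀ (by norm_num)
  have hB0 : 0 < B := by linarith
  have h2q : ((2 : ℝ) ^ q) * 2 ^ q = B := by rw [hB, ← mul_pow]; norm_num
  -- Three of the 2^k dimensions are reserved for padding; exponent 31 instead of 30 makes room for
  -- them.
  obtain ⟨d, hd, hdn⟩ : ∃ d : ℕ, d + 3 = 2 ^ k ∧ 2 ^ (30 + 8 * q) * n ≤ d := by
    have h1 : n ≤ 2 ^ Nat.clog 2 n := Nat.le_pow_clog (by norm_num) n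
    have h2 : 2 ^ k = 2 * (2 ^ (30 + 8 * q) * 2 ^ Nat.clog 2 n) := by
      rw [hk, ← pow_add, ← pow_succ']; congr 1; omega
    have h3 : 2 ^ (30 + 8 * q) * n ≤ 2 ^ (30 + 8 * q) * 2 ^ Nat.clog 2 n := Nat.mul_le_mul_left _ h1
    have h4 : 4 ≤ 2 ^ (30 + 8 * q) * n := by
      have : 2 ^ 2 ≤ 2 ^ (30 + 8 * q) := Nat.pow_le_pow_right (by norm_num) (by omega)
      nlinarith
    exact ⟨2 ^ k - 3, by omega, by omega⟩
  have hdR : (2 : ℝ) ^ (30 + 8 * q) * n ≤ d := by exact_mod_cast hdn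
  have hd0 : 0 < d := lt_of_lt_of_le (by positivity) hdn
  -- Both parties' vectors form one family, so a single reduction also preserves the mixed inner
  -- products.
  let w : (Fin n → Bool) ⊕ (Fin n → Bool) → Fin N → ℝ :=
    Sum.elim (fun x k => u x k / 2 ^ q) (fun y k => v y k / 2 ^ q)
  have hdiv : ∀ a b : Fin N → ℝ, ∑ k, a k / 2 ^ q * (b k / 2 ^ q) = (∑ k, a k * b k) / B := by
    intro a b
    rw [Finset.sum_div]
    exact Finset.sum_congr rfl fun k _ => by rw [div_mul_div_comm, h2q]
  have hw : ∀ i, ∑ k, w i k ^ 2 ≤ 1 := by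
    intro i
    cases i with
    | inl x =>
      simp only [w, Sum.elim_inl, pow_two, hdiv]
      rw [div_le_one hB0]; simpa only [pow_two] using hu x
    | inr y =>
      simp only [w, Sum.elim_inr, pow_two, hdiv]
      rw [div_le_one hB0]; simpa only [pow_two] using hv y
  have hε1 : 1 / (12 * B) ≤ 1 := by rw [div_le_one (by positivity)]; linarith
  obtain ⟨φ, hφ⟩ := exists_dimension_reduction w hw (1 / (12 * B)) (by positivity) hε1 d hd0 (by
    simpa using two_mul_card_sq_lt_exp hn hdR)
  have hφ2 : ∀ i, ∑ k, φ i k * φ i k ≤ 2 := by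
    intro i
    have h1 := (abs_le.1 (hφ i i)).2
    have h2 := hw i
    simp only [pow_two] at h2
    linarith
  have hinner : ∀ i j, |∑ k, φ i k * φ j k| ≤ 2 := by
    intro i j
    have h1 : 0 ≤ ∑ k, (φ i k - φ j k) ^ 2 := Finset.sum_nonneg fun k _ => sq_nonneg _
    have h2 : 0 ≤ ∑ k, (φ i k + φ j k) ^ 2 := Finset.sum_nonneg fun k _ => sq_nonneg _
    have e1 : ∑ k, (φ i k - φ j k) ^ 2 = ∑ k, φ i k * φ i k + ∑ k, φ j k * φ j k
        - 2 * ∑ k, φ i k * φ j k := by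
      rw [Finset.mul_sum, ← Finset.sum_add_distrib, ← Finset.sum_sub_distrib]
      exact Finset.sum_congr rfl fun k _ => by ring
    have e2 : ∑ k, (φ i k + φ j k) ^ 2 = ∑ k, φ i k * φ i k + ∑ k, φ j k * φ j k
        + 2 * ∑ k, φ i k * φ j k := by
      rw [Finset.mul_sum, ← Finset.sum_add_distrib, ← Finset.sum_add_distrib]
      exact Finset.sum_congr rfl fun k _ => by ring
    have := hφ2 i
    have := hφ2 j
    rw [abs_le]; constructor <;> linarith
  obtain ⟨α, β, hα, hβ, hαβ⟩ := exists_unit_vectors hd (fun x => φ (Sum.inl x))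
    (fun y => φ (Sum.inr y)) (fun x => hφ2 _) (fun y => hφ2 _)
  set c : ℝ := 1 / (48 * B) with hc
  have hc0 : 0 < c := by positivity
  have hc1 : c ≤ 1 / 48 := by
    rw [hc]; exact one_div_le_one_div_of_le (by norm_num) (by linarith)
  -- With accuracy 4c, acceptance probabilities 2/3 and 1/3 give quarter inner products at least
  -- 32c/4 - c = 7c and at most 16c/4 + c = 5c. `m` is the midpoint of the resulting swap
  -- probabilities, at distance c/2 + 6c² from each; `hr` uses c/2, whence 32/c² = 73728 · 16^q
  -- repetitions.
  let m : ℝ := 1 / 2 + ((1 / 2 + 7 * c) ^ 2 + (1 / 2 + 5 * c) ^ 2) / 4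
  let F : RepeatedFingerprinting (Fin n → Bool) (Fin n → Bool) k (73728 * 2 ^ (4 * q)) :=
    ⟨α, β, hα, hβ, ⌈((73728 * 2 ^ (4 * q) : ℕ) : ℝ) * m⌉₊⟩
  have hr : 8 / (c / 2) ^ 2 ≤ ((73728 * 2 ^ (4 * q) : ℕ) : ℝ) := by
    have h4 : (2 : ℝ) ^ (4 * q) = B ^ 2 := by
      rw [hB, ← pow_mul, show (4 : ℝ) = 2 ^ 2 by norm_num, ← pow_mul]; ring_nf
    push_cast
    rw [h4, hc]
    refine le_of_eq ?_
    field_simp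
    norm_num
  refine ⟨F, fun x y hxy => ?_⟩
  have hacc : F.acceptProb x y =
      tailProb (73728 * 2 ^ (4 * q)) ⌈((73728 * 2 ^ (4 * q) : ℕ) : ℝ) * m⌉₊ (F.swapProb x y) := rfl
  set s := ∑ k, φ (Sum.inl x) k * φ (Sum.inr y) k with hs
  have hsw : F.swapProb x y = 1 / 2 + (1 / 2 + s / 4) ^ 2 / 2 := by
    simp only [RepeatedFingerprinting.swapProb, F, hαβ]; rfl
  have hs2 := abs_le.1 (hinner (Sum.inl x) (Sum.inr y))
  rw [← hs] at hs2
  have hsP := abs_le.1 (hφ (Sum.inl x) (Sum.inr y))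
  simp only [w, Sum.elim_inl, Sum.elim_inr, hdiv, ← huv] at hsP
  rw [← hs] at hsP
  have he : 1 / (12 * B) = 4 * c := by rw [hc]; field_simp; norm_num
  have hPB : P.acceptProb x y / B = 48 * c * P.acceptProb x y := by rw [hc]; field_simp
  rw [he, hPB] at hsP
  have hp0 : 0 ≤ F.swapProb x y := by rw [hsw]; positivity
  have hp1 : F.swapProb x y ≤ 1 := by rw [hsw]; nlinarith
  rw [hacc]
  constructor
  · intro hf
    have hge := (hP x y hxy).1 hf
    refine le_tailProb hp0 hp1 (half_pos hc0) (by linarith) hr ?_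
    have hs7 : 7 * c ≤ s / 4 := by nlinarith
    rw [hsw]
    simp only [m]
    nlinarith
  · intro hf
    have hle := (hP x y hxy).2 hf
    refine tailProb_le hp0 hp1 (half_pos hc0) (by linarith) hr ?_
    have hs5 : s / 4 ≤ 5 * c := by nlinarith
    rw [hsw]
    simp only [m]
    have : (1 / 2 + s / 4) ^ 2 ≤ (1 / 2 + 5 * c) ^ 2 :=
      pow_le_pow_left₀ (by linarith) (by linarith) 2
    nlinarith

/-! ### The trivial protocol -/

-- Induction on the bits still to be sent. `g` is the basis state recording what Bob already holds;
-- the hypothesis says that it determines f together with the remaining bits `c`.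
open scoped Matrix in
theorem exists_interaction_sending_bits {X Y : Type} (f : X → Y → Bool) :
    ∀ (m b : ℕ) (g : X → Fin b) (c : Fin m → X → Fin 2),
      (∀ x x' y, g x = g x' → (∀ i, c i x = c i x') → f x y = f x' y) →
      ∃ I : Interaction X Y 1 b m, ∀ x y,
        I.acceptProb x y (Matrix.of fun _ j => if j = g x then 1 else 0)
          = if f x y = true then 1 else 0 := by
  classical
  intro m
  induction m with
  | zero =>
    intro b g c h
    let v : Y → Fin b → ℂ := fun y j => if ∃ x, g x = j ∧ f x y = true then 1 else 0
    refine ⟨.outB (fun y => Matrix.diagonal (v y)) fun y => ⟨?_, ?_⟩, fun x y => ?_⟩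
    · refine Matrix.PosSemidef.diagonal fun j => ?_
      simp only [v]; split_ifs <;> simp
    · rw [← Matrix.diagonal_one, Matrix.diagonal_sub]
      refine Matrix.PosSemidef.diagonal fun j => ?_
      simp only [v]; split_ifs <;> simp
    · have hv : v y (g x) = if f x y = true then 1 else 0 := by
        refine if_congr ⟨?_, fun hf => ⟨x, rfl, hf⟩⟩ rfl rfl
        rintro ⟨x', hx, hf⟩
        rw [h x x' y hx.symm fun i => i.elim0, hf]
      have : (Matrix.of fun (_ : Fin 1) j => if j = g x then (1 : ℂ) else 0)
          * (Matrix.diagonal (v y))ᵀ * (Matrix.of fun (_ : Fin 1) j => if j = g x then (1 : ℂ) else 0)ᴴ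
          = Matrix.of fun _ _ => v y (g x) := by
        ext i j
        simp [Matrix.mul_apply, Matrix.diagonal_apply]
      simp only [Interaction.acceptProb]
      rw [this, Matrix.trace, hv]
      simp only [Finset.univ_unique, Finset.sum_singleton, Matrix.diag_apply, Matrix.of_apply]
      split_ifs <;> simp
  | succ m ih =>
    intro b g c h
    obtain ⟨I, hI⟩ := ih (b * 2) (fun x => finProdFinEquiv (g x, c 0 x)) (fun i => c i.succ) (by
      intro x x' y hg hc
      have hgc := Prod.mk.inj (finProdFinEquiv.injective hg)
      exact h x x' y hgc.1 (Fin.cases hgc.2 hc))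
    refine ⟨.sendA 1 (fun x => Matrix.of fun p _ => if p.2 = c 0 x then 1 else 0) (fun x => ?_) I,
      fun x y => ?_⟩
    · ext i j
      fin_cases i; fin_cases j
      simp [Matrix.mul_apply, Fintype.sum_prod_type]
    · rw [Interaction.acceptProb, ← hI x y]
      congr 1
      ext i j
      obtain ⟨⟨j, l⟩, rfl⟩ := finProdFinEquiv.surjective j
      simp only [transferA, Matrix.of_apply, Equiv.symm_apply_apply, Matrix.mul_apply,
        Finset.univ_unique, Finset.sum_singleton, EmbeddingLike.apply_eq_iff_eq, Prod.mk.injEq]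
      by_cases h1 : j = g x <;> by_cases h2 : l = c 0 x <;> simp [h1, h2]

/-- Every function has a protocol, in which Alice sends all the bits of her input. -/
theorem exists_entProtocol {n : ℕ} (D : Set ((Fin n → Bool) × (Fin n → Bool)))
    (f : (Fin n → Bool) → (Fin n → Bool) → Bool) :
    ∃ (q : ℕ) (P : EntProtocol (Fin n → Bool) (Fin n → Bool) q), BoundedError D f P.acceptProb := by
  obtain ⟨I, hI⟩ := exists_interaction_sending_bits f n 1 (fun _ => 0)
    (fun i x => if x i then 1 else 0) (by
      intro x x' y _ h
      have : x = x' := funext fun i => by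
        have := h i
        cases hx : x i <;> cases hx' : x' i <;> simp_all
      rw [this])
  refine ⟨n, ⟨1, 1, Matrix.of fun _ j => if j = 0 then 1 else 0, by simp, I⟩, fun x y _ => ?_⟩
  have := hI x y
  simp only [EntProtocol.acceptProb, this]
  constructor <;> intro h <;> (simp [h]; try norm_num)

/-! ### Swap tests as one referee measurement -/

/-- The tensor product of `r` square matrices. -/
def tensor {L : Type} {r : ℕ} (A : Fin r → Matrix L L ℂ) : Matrix (Fin r → L) (Fin r → L) ℂ :=
  Matrix.of fun p q => ∏ i, A i (p i) (q i)

theorem sum_prod_eq {L : Type} [Fintype L] {r : ℕ} (g : Fin r → L → ℂ) :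
    ∑ p : Fin r → L, ∏ i, g i (p i) = ∏ i, ∑ l, g i l := by
  rw [Finset.prod_univ_sum, Fintype.piFinset_univ]

theorem tensor_mul {L : Type} [Fintype L] {r : ℕ} (A B : Fin r → Matrix L L ℂ) :
    tensor A * tensor B = tensor fun i => A i * B i := by
  ext p q
  simp only [tensor, Matrix.mul_apply, Matrix.of_apply, ← Finset.prod_mul_distrib]
  exact sum_prod_eq fun i l => A i (p i) l * B i l (q i)

theorem trace_tensor {L : Type} [Fintype L] {r : ℕ} (A : Fin r → Matrix L L ℂ) :
    (tensor A).trace = ∏ i, (A i).trace :=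
  sum_prod_eq fun i l => A i l l

theorem tensor_one {L : Type} [DecidableEq L] {r : ℕ} :
    tensor (fun _ : Fin r => (1 : Matrix L L ℂ)) = 1 := by
  ext p q
  simp only [tensor, Matrix.of_apply, Matrix.one_apply]
  rw [Finset.prod_ite_zero]
  simp [funext_iff]

theorem conjTranspose_tensor {L : Type} {r : ℕ} (A : Fin r → Matrix L L ℂ) :
    (tensor A).conjTranspose = tensor fun i => (A i).conjTranspose := by
  ext p q
  simp [tensor]

theorem sum_tensor {L : Type} {r : ℕ} (W : Fin 2 → Matrix L L ℂ) :
    ∑ o : Fin r → Fin 2, tensor (fun i => W (o i)) = tensor fun _ => ∑ c, W c := by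
  ext p q
  simp only [tensor, Matrix.sum_apply, Matrix.of_apply]
  exact sum_prod_eq fun i c => W c (p i) (q i)

/-- A tensor product T of orthogonal projections satisfies T = T†T. -/
theorem posSemidef_tensor_of_isIdempotent {L : Type} [Fintype L] {r : ℕ}
    (A : Fin r → Matrix L L ℂ) (h : ∀ i, A i * A i = A i)
    (h' : ∀ i, (A i).conjTranspose = A i) : (tensor A).PosSemidef := by
  have : tensor A = (tensor A).conjTranspose * tensor A := by
    rw [conjTranspose_tensor, tensor_mul]
    simp only [h', h]
  rw [this]
  exact Matrix.posSemidef_conjTranspose_mul_self _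

theorem tensor_vecMulVec {L : Type} {r : ℕ} (v : L → ℂ) :
    tensor (fun _ : Fin r => Matrix.vecMulVec v (star v))
      = Matrix.vecMulVec (fun p => ∏ i, v (p i)) (star fun p => ∏ i, v (p i)) := by
  ext p q
  simp [tensor, Matrix.vecMulVec_apply, Finset.prod_mul_distrib]

theorem trace_submatrix_equiv {m n : Type} [Fintype m] [Fintype n] (A : Matrix n n ℂ) (e : m ≃ n) :
    (A.submatrix e e).trace = A.trace :=
  e.sum_comp fun i => A i i

/-- The operator exchanging two registers. -/
def swapMatrix (K : Type) [DecidableEq K] : Matrix (K × K) (K × K) ℂ :=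
  (1 : Matrix (K × K) (K × K) ℂ).submatrix id Prod.swap

theorem swapMatrix_mul_apply {K : Type} [Fintype K] [DecidableEq K]
    (A : Matrix (K × K) (K × K) ℂ) (p q : K × K) : (swapMatrix K * A) p q = A p.swap q := by
  have : ∀ z : K × K, p = z.swap ↔ p.swap = z := fun z => by
    rw [← Prod.swap_inj, Prod.swap_swap]
  simp [swapMatrix, Matrix.mul_apply, Matrix.one_apply, this]

theorem swapMatrix_mul_self (K : Type) [Fintype K] [DecidableEq K] :
    swapMatrix K * swapMatrix K = 1 := by
  ext p q
  rw [swapMatrix_mul_apply]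
  simp [swapMatrix, Matrix.one_apply]

theorem conjTranspose_swapMatrix (K : Type) [DecidableEq K] :
    (swapMatrix K).conjTranspose = swapMatrix K := by
  ext p q
  have : q = p.swap ↔ p = q.swap := by rw [eq_comm, Prod.swap_eq_iff_eq_swap]
  simp [swapMatrix, Matrix.one_apply, this, apply_ite]

/-- The two projections measured in the swap test. -/
noncomputable def swapProj (K : Type) [DecidableEq K] (c : Fin 2) : Matrix (K × K) (K × K) ℂ :=
  (1 / 2 : ℂ) • if c = 0 then 1 + swapMatrix K else 1 - swapMatrix K

theorem swapProj_mul_self (K : Type) [Fintype K] [DecidableEq K] (c : Fin 2) :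
    swapProj K c * swapProj K c = swapProj K c := by
  have h := swapMatrix_mul_self K
  unfold swapProj
  rw [Matrix.smul_mul, Matrix.mul_smul, smul_smul]
  split_ifs
  · have : (1 + swapMatrix K) * (1 + swapMatrix K) = (2 : ℂ) • (1 + swapMatrix K) := by
      rw [mul_add, add_mul, add_mul, h, two_smul]; simp; abel
    rw [this, smul_smul]; norm_num
  · have : (1 - swapMatrix K) * (1 - swapMatrix K) = (2 : ℂ) • (1 - swapMatrix K) := by
      rw [mul_sub, sub_mul, sub_mul, h, two_smul]; simp; abel
    rw [this, smul_smul]; norm_num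

theorem conjTranspose_swapProj (K : Type) [DecidableEq K] (c : Fin 2) :
    (swapProj K c).conjTranspose = swapProj K c := by
  unfold swapProj
  split_ifs <;> simp [conjTranspose_swapMatrix]

theorem sum_swapProj (K : Type) [DecidableEq K] : ∑ c, swapProj K c = 1 := by
  rw [Fin.sum_univ_two]
  simp only [swapProj, if_true, if_neg (one_ne_zero (α := Fin 2))]
  rw [← smul_add, add_add_sub_cancel, ← two_smul ℂ, smul_smul]
  norm_num

/-- The swap trick tr(S(ρ ⊗ σ)) = tr(ρσ), for pure states. -/
theorem trace_swapMatrix_mul {K : Type} [Fintype K] [DecidableEq K] (v w : EuclideanSpace ℂ K) :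
    (swapMatrix K * (Matrix.vecMulVec v (star v.ofLp) ⊗ₖ Matrix.vecMulVec w (star w.ofLp))).trace
      = ((‖inner ℂ v w‖ ^ 2 : ℝ) : ℂ) := by
  have h : (((‖inner ℂ v w‖ : ℝ) ^ 2 : ℝ) : ℂ) = inner ℂ v w * star (inner ℂ v w) := by
    have := Complex.mul_conj' (inner ℂ v w : ℂ)
    push_cast
    exact this.symm
  rw [h, PiLp.inner_apply, star_sum, Finset.sum_mul_sum, Matrix.trace, Fintype.sum_prod_type]
  refine Finset.sum_congr rfl fun i _ => Finset.sum_congr rfl fun j _ => ?_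
  rw [Matrix.diag_apply, swapMatrix_mul_apply]
  simp only [Matrix.kroneckerMap_apply, Matrix.vecMulVec_apply, Prod.swap, Pi.star_apply]
  simp
  ring

theorem trace_vecMulVec_star {K : Type} [Fintype K] (v : EuclideanSpace ℂ K) (hv : ‖v‖ = 1) :
    (Matrix.vecMulVec v.ofLp (star v.ofLp)).trace = 1 := by
  have := EuclideanSpace.norm_sq_eq v
  rw [hv] at this
  rw [Matrix.trace]
  have h : ∀ i, v i * star (v i) = ((‖v i‖ ^ 2 : ℝ) : ℂ) := fun i => by
    push_cast
    exact Complex.mul_conj' _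
  simp only [Matrix.diag_apply, Matrix.vecMulVec_apply, Pi.star_apply, h]
  rw [← Complex.ofReal_sum, ← this]
  simp

/-- Repeated fingerprinting is a simultaneous message passing protocol. -/
theorem RepeatedFingerprinting.exists_smpProtocol {X Y : Type} {k r : ℕ}
    (F : RepeatedFingerprinting X Y k r) :
    ∃ P : SMPProtocol X Y (k * r) (k * r), ∀ x y, P.acceptProb x y = F.acceptProb x y := by
  let K := Fin (2 ^ k)
  let e : Fin (2 ^ (k * r)) ≃ (Fin r → K) :=
    (finCongr (pow_mul 2 k r)).trans finFunctionFinEquiv.symm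
  -- Regroups two blocks of r fingerprints into the r pairs that are tested.
  let G : Fin (2 ^ (k * r)) × Fin (2 ^ (k * r)) ≃ (Fin r → K × K) :=
    (Equiv.prodCongr e e).trans (Equiv.arrowProdEquivProdArrow _ _ _).symm
  let acc : Finset (Fin r → Fin 2) := Finset.univ.filter fun o =>
    F.threshold ≤ (Finset.univ.filter fun i => o i = 0).card
  let M : (Fin r → Fin 2) → Matrix (Fin r → K × K) (Fin r → K × K) ℂ :=
    fun o => tensor fun i => swapProj K (o i)
  have hM : ∀ o, (M o).PosSemidef := fun o => posSemidef_tensor_of_isIdempotent _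
    (fun i => swapProj_mul_self K _) fun i => conjTranspose_swapProj K _
  have hM1 : ∑ o, M o = 1 := by rw [sum_tensor, sum_swapProj, tensor_one]
  have hdens : ∀ v : EuclideanSpace ℂ K, ‖v‖ = 1 → IsDensity
      ((tensor fun _ : Fin r => Matrix.vecMulVec v.ofLp (star v.ofLp)).submatrix e e) := by
    intro v hv
    refine ⟨?_, ?_⟩
    · rw [tensor_vecMulVec]
      exact (Matrix.posSemidef_vecMulVec_self_star _).submatrix e
    · rw [trace_submatrix_equiv, trace_tensor]
      simp [trace_vecMulVec_star v hv]
  have hE : IsEffect ((∑ o ∈ acc, M o).submatrix G G) := by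
    refine ⟨(Matrix.posSemidef_sum _ fun o _ => hM o).submatrix G, ?_⟩
    -- The outcome projections sum to 1, so the rejecting operator is the sum over the other outcome
    -- strings and is again positive.
    have : (1 : Matrix (Fin (2 ^ (k * r)) × Fin (2 ^ (k * r))) _ ℂ)
        - (∑ o ∈ acc, M o).submatrix G G = (∑ o ∈ accᶜ, M o).submatrix G G := by
      rw [← Matrix.submatrix_one_equiv G, ← hM1, ← Finset.sum_add_sum_compl acc M]
      ext i j
      simp
    rw [this]
    exact (Matrix.posSemidef_sum _ fun o _ => hM o).submatrix G
  refine ⟨⟨_, _, _, fun x => hdens (F.α x) (F.norm_α x), fun y => hdens (F.β y) (F.norm_β y), hE⟩,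
    fun x y => ?_⟩
  set τ := Matrix.vecMulVec (F.α x).ofLp (star (F.α x).ofLp) ⊗ₖ
    Matrix.vecMulVec (F.β y).ofLp (star (F.β y).ofLp) with hτ
  have hkr : (tensor fun _ : Fin r => Matrix.vecMulVec (F.α x).ofLp (star (F.α x).ofLp)).submatrix e e
      ⊗ₖ (tensor fun _ : Fin r => Matrix.vecMulVec (F.β y).ofLp (star (F.β y).ofLp)).submatrix e e
      = (tensor fun _ : Fin r => τ).submatrix G G := by
    ext p q
    simp only [tensor, Matrix.kroneckerMap_apply, Matrix.submatrix_apply, Matrix.of_apply,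
      ← Finset.prod_mul_distrib]
    rfl
  have hτ1 : τ.trace = 1 := by
    rw [hτ, Matrix.trace_kronecker, trace_vecMulVec_star _ (F.norm_α x),
      trace_vecMulVec_star _ (F.norm_β y), one_mul]
  have hW : ∀ c : Fin 2, (swapProj K c * τ).trace =
      ((if c = 0 then F.swapProb x y else 1 - F.swapProb x y : ℝ) : ℂ) := by
    intro c
    have hs := trace_swapMatrix_mul (F.α x) (F.β y)
    rw [← hτ] at hs
    unfold swapProj
    rw [Matrix.smul_mul, Matrix.trace_smul]
    split_ifs
    · rw [Matrix.add_mul, Matrix.trace_add, Matrix.one_mul, hs, hτ1, RepeatedFingerprinting.swapProb]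
      push_cast
      simp only [smul_eq_mul]; ring
    · rw [Matrix.sub_mul, Matrix.trace_sub, Matrix.one_mul, hs, hτ1, RepeatedFingerprinting.swapProb]
      push_cast
      simp only [smul_eq_mul]; ring
  simp only [SMPProtocol.acceptProb, RepeatedFingerprinting.acceptProb]
  rw [hkr, Matrix.submatrix_mul_equiv, trace_submatrix_equiv, Finset.sum_mul,
    Matrix.trace_sum, ← Finset.sum_filter, Complex.re_sum]
  refine Finset.sum_congr rfl fun o _ => ?_
  rw [tensor_mul, trace_tensor]
  simp only [hW]
  rw [← Complex.ofReal_prod, Complex.ofReal_re]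

/-! ### Final bounds -/

theorem clog_two_le {n : ℕ} (hn : 2 ≤ n) :
    1 ≤ Real.logb 2 n ∧ (Nat.clog 2 n : ℝ) ≤ 2 * Real.logb 2 n := by
  have h1 : 1 ≤ Real.logb 2 n := by
    rw [Real.le_logb_iff_rpow_le one_lt_two (by positivity)]
    simpa using hn
  refine ⟨h1, ?_⟩
  have h2 : ((Nat.clog 2 n - 1 : ℕ) : ℝ) ≤ Real.logb 2 n := by
    rw [Real.le_logb_iff_rpow_le one_lt_two (by positivity), Real.rpow_natCast]
    exact_mod_cast (Nat.pow_pred_clog_lt_self one_lt_two hn).le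
  have h3 : (Nat.clog 2 n : ℝ) ≤ ((Nat.clog 2 n - 1 : ℕ) : ℝ) + 1 := by
    exact_mod_cast (by omega : Nat.clog 2 n ≤ Nat.clog 2 n - 1 + 1)
  linarith

theorem Qpar_le_of_repeatedFingerprinting {X Y : Type} {D : Set (X × Y)} {f : X → Y → Bool}
    {k r : ℕ} (F : RepeatedFingerprinting X Y k r) (hF : BoundedError D f F.acceptProb) :
    Qpar D f ≤ 2 * k * r := by
  obtain ⟨P, hP⟩ := F.exists_smpProtocol
  refine Nat.sInf_le ⟨k * r, k * r, by ring, P, fun x y hxy => ?_⟩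
  rw [hP]
  exact hF x y hxy

end QFP

theorem theorem4 :
    ∃ C : ℝ, 0 < C ∧
      ∀ n : ℕ, 2 ≤ n →
      ∀ (D : Set ((Fin n → Bool) × (Fin n → Bool))) (f : (Fin n → Bool) → (Fin n → Bool) → Bool),
        (∀ (q : ℕ) (P : QFP.EntProtocol (Fin n → Bool) (Fin n → Bool) q),
          QFP.BoundedError D f P.acceptProb →
          ∃ (k r : ℕ) (F : QFP.RepeatedFingerprinting (Fin n → Bool) (Fin n → Bool) k r),
            QFP.BoundedError D f F.acceptProb ∧
            (k : ℝ) ≤ C * (q + Real.logb 2 n) ∧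
            (r : ℝ) ≤ C * 2 ^ (8 * q) ∧
            (2 * k * r : ℝ) ≤ C * 2 ^ (8 * q) * Real.logb 2 n) ∧
        (QFP.Qpar D f : ℝ) ≤ C * 2 ^ (8 * QFP.Qent D f) * Real.logb 2 n := by
  refine ⟨10 ^ 7, by norm_num, fun n hn D f => ?_⟩
  obtain ⟨hlog, hclog⟩ := QFP.clog_two_le hn
  set l := Real.logb 2 n
  have main : ∀ (q : ℕ) (P : QFP.EntProtocol (Fin n → Bool) (Fin n → Bool) q),
      QFP.BoundedError D f P.acceptProb →
      ∃ (k r : ℕ) (F : QFP.RepeatedFingerprinting (Fin n → Bool) (Fin n → Bool) k r),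
        QFP.BoundedError D f F.acceptProb ∧
        (k : ℝ) ≤ 10 ^ 7 * (q + l) ∧
        (r : ℝ) ≤ 10 ^ 7 * 2 ^ (8 * q) ∧
        (2 * k * r : ℝ) ≤ 10 ^ 7 * 2 ^ (8 * q) * l := by
    intro q P hP
    obtain ⟨F, hF⟩ := P.exists_repeatedFingerprinting hn hP
    have hq0 : (0 : ℝ) ≤ q := Nat.cast_nonneg q
    set s : ℝ := 2 ^ (4 * q) with hs
    have hs8 : (2 : ℝ) ^ (8 * q) = s * s := by rw [hs, ← pow_add]; ring_nf
    have hs1 : 1 ≤ s := one_le_pow₀ (by norm_num)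
    have hqs : (q : ℝ) ≤ s := by
      have : q ≤ 2 ^ (4 * q) :=
        Nat.lt_two_pow_self.le.trans (Nat.pow_le_pow_right two_pos (by omega))
      rw [hs]; exact_mod_cast this
    have hk : ((31 + 8 * q + Nat.clog 2 n : ℕ) : ℝ) ≤ 33 * l + 8 * q := by
      push_cast; linarith
    have hr : ((73728 * 2 ^ (4 * q) : ℕ) : ℝ) = 73728 * s := by push_cast; rfl
    refine ⟨_, _, F, hF, ?_, ?_, ?_⟩
    · refine hk.trans ?_
      linarith
    · rw [hr, hs8]
      nlinarith
    · rw [hr, hs8]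
      -- Here q ≤ 2^(4q) and log n ≥ 1 turn a sum into a product; then 2 · 41 · 73728 ≤ 10^7 fixes
      -- the constant.
      have h1 : 33 * l + 8 * q ≤ 41 * (s * l) := by nlinarith
      have h2 : ((31 + 8 * q + Nat.clog 2 n : ℕ) : ℝ) ≤ 41 * (s * l) := hk.trans h1
      have h3 : 0 ≤ s * s * l := by positivity
      calc 2 * ((31 + 8 * q + Nat.clog 2 n : ℕ) : ℝ) * (73728 * s)
          ≤ 2 * (41 * (s * l)) * (73728 * s) := by gcongr
        _ ≤ _ := by linarith
  refine ⟨main, ?_⟩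
  -- Nonemptiness matters: `sInf ∅ = 0` in ℕ would leave no protocol to convert.
  obtain ⟨P, hP⟩ := Nat.sInf_mem (s := {q : ℕ | ∃ P : QFP.EntProtocol (Fin n → Bool)
    (Fin n → Bool) q, QFP.BoundedError D f P.acceptProb}) (QFP.exists_entProtocol D f)
  obtain ⟨k, r, F, hF, -, -, h⟩ := main _ P hP
  refine le_trans ?_ h
  exact_mod_cast QFP.Qpar_le_of_repeatedFingerprinting F hF
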